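/- **Proposition.** For a group $G$ let $R(G)$ be the affine representation ring of $G$ in $SL_2(\mathbb{C})$: the commutative $\mathbb{C}$-algebra generated by the entries of $2\times 2$ matrices $x_g$ ($g\in G$) subject to $\det x_g=1$, $x_1=1$ and $x_{gh}=x_gx_h$. Let $\chi(G)=R(G)^{SL_2(\mathbb{C})}$ be the affine character ring, the subring of invariants under conjugation. Let $K$ be a tame knot in $S^3$ with a meridian $\mu$ and preferred longitude $\lambda$ on the boundary torus $T^2$ of a tubular neighbourhood. Let $\mathcal{I}(K)$ be the kernel of the restriction map $\hat r:\chi(\pi_1(T^2))\to\chi(\pi_1(S^3\setminus K))$, where $\pi_1(T^2)$ is the free abelian group on $\lambda,\mu$. Let $\hat p:\chi(\pi_1(T^2))\to\mathbb{C}[l^{\pm1},m^{\pm1}]$ be the map dual to the map that sends $(l,m)\in\mathbb{C}^*\times\mathbb{C}^*$ to the character of the representation $\lambda\mapsto\mathrm{diag}(l,l^{-1})$, $\mu\mapsto\mathrm{diag}(m,m^{-1})$. Let $Y(K)\subset\mathbb{C}^*\times\mathbb{C}^*$ be the set of pairs of upper left entries of $\phi(\lambda),\phi(\mu)$, where $\phi$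 runs over the representations of $\pi_1(S^3\setminus K)$ in $SL_2(\mathbb{C})$ that send the peripheral subgroup to upper triangular matrices. Let $Y_D(K)\subset Y(K)$ be the subset obtained from those $\phi$ that send the peripheral subgroup to diagonal matrices. A Laurent polynomial $B(l,m)$ is called a *$B$-polynomial* of $K$ if it generates the ideal of all Laurent polynomials that vanish on $Y(K)$. A Laurent polynomial $A(l,m)$ is called an *$A$-polynomial* of $K$ if $(l-1)A(l,m)$ is a $B$-polynomial of $K$ and $l-1$ does not divide $A(l,m)$. 1. If $B(l,m)$ is a $B$-polynomial of $K$, then the radical of the ideal of $\mathbb{C}[l^{\pm1},m^{\pm1}]$ generated by $\hat p(\mathcal{I}(K))$ is the principal ideal $(B(l,m))$. Moreover $(B(l,m))$ is also the ideal of all Laurent polynomials that vanish on $Y_D(K)$. 2. If $A(l,m)$ is an $A$-polynomial of $K$, then this radical is $((l-1)A(l,m))$. 3. Hence $\mathcal{I}(K)$ determines the A-polynomial: if $K'$ is another such knot, $\mathcal{I}(K)=\mathcal{I}(K')$, and $A$ is an $A$-polynomial of $K$, then a Laurent polynomial $A'$ is an $A$-polynomial of $K'$ if and only if $A'=uA$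 for a unit $u$ of $\mathbb{C}[l^{\pm1},m^{\pm1}]$. -/

import Mathlib

open scoped MatrixGroups

noncomputable section

namespace AffineChar

/-! ### The affine representation ring and the affine character ring of a group -/

section RepRing

variable (G : Type*) [Group G]

/-- The generic matrix `x_g = (x_{g,i,j})` attached to `g ∈ G`, with indeterminate entries. -/
def genMatrix (g : G) : Matrix (Fin 2) (Fin 2) (MvPolynomial (G × Fin 2 × Fin 2) ℂ) :=
  Matrix.of fun i j => MvPolynomial.X (g, i, j)

/-- The relations saying that `g ↦ x_g` is a homomorphism into `SL₂`: `det x_g = 1`,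
`x_1 = 1` and `x_{gh} = x_g x_h`, entry by entry. -/
def repRelations : Set (MvPolynomial (G × Fin 2 × Fin 2) ℂ) :=
  {q | (∃ g, q = (genMatrix G g).det - 1) ∨
    (∃ i j, q = (genMatrix G 1 - 1) i j) ∨
    ∃ g h i j, q = (genMatrix G (g * h) - genMatrix G g * genMatrix G h) i j}

/-- The (unreduced) affine representation ring `R(G)`: the coordinate ring of a product of copies
of `SL₂(ℂ)` indexed by generators, modulo the ideal of the relations. Here all elements of `G` are
generators and the multiplication table is the set of relations, so no presentation is chosen. -/
abbrev RepRing : Type _ :=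
  MvPolynomial (G × Fin 2 × Fin 2) ℂ ⧸ Ideal.span (repRelations G)

variable {G}

set_option linter.unusedSectionVars false in
theorem genMatrix_map {S : Type*} [CommRing S] [Algebra ℂ S] (φ : G → Matrix (Fin 2) (Fin 2) S)
    (g : G) :
    (genMatrix G g).map (MvPolynomial.aeval (R := ℂ) fun p : G × Fin 2 × Fin 2 =>
      φ p.1 p.2.1 p.2.2) = φ g := by
  ext i j
  simp [genMatrix]

/-- The matrix of classes of `x_{g,i,j}` in `R(G)`. -/
def univMatrix (g : G) : Matrix (Fin 2) (Fin 2) (RepRing G) :=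
  (genMatrix G g).map (Ideal.Quotient.mk _)

theorem univMatrix_det (g : G) : (univMatrix g).det = 1 := by
  have h : Ideal.Quotient.mk (Ideal.span (repRelations G)) ((genMatrix G g).det - 1) = 0 :=
    Ideal.Quotient.eq_zero_iff_mem.2 (Ideal.subset_span (Or.inl ⟨g, rfl⟩))
  rw [map_sub, map_one, sub_eq_zero, RingHom.map_det] at h
  exact h

theorem univMatrix_one : univMatrix (1 : G) = 1 := by
  ext i j
  have h : Ideal.Quotient.mk (Ideal.span (repRelations G)) ((genMatrix G 1 - 1) i j) = 0 :=
    Ideal.Quotient.eq_zero_iff_mem.2 (Ideal.subset_span (Or.inr (Or.inl ⟨i, j, rfl⟩)))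
  rw [Matrix.sub_apply, map_sub, sub_eq_zero] at h
  refine h.trans ?_
  by_cases hij : i = j <;> simp [Matrix.one_apply, hij]

theorem univMatrix_mul (g h : G) : univMatrix (g * h) = univMatrix g * univMatrix h := by
  ext i j
  have e : Ideal.Quotient.mk (Ideal.span (repRelations G))
      ((genMatrix G (g * h) - genMatrix G g * genMatrix G h) i j) = 0 :=
    Ideal.Quotient.eq_zero_iff_mem.2
      (Ideal.subset_span (Or.inr (Or.inr ⟨g, h, i, j, rfl⟩)))
  rw [Matrix.sub_apply, map_sub, sub_eq_zero] at e
  refine e.trans ?_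
  simp [Matrix.mul_apply, univMatrix]

variable (G) in
/-- The universal representation `G → SL₂(R(G))`, `g ↦ x_g`. -/
def univRep : G →* SL(2, RepRing G) where
  toFun g := ⟨univMatrix g, univMatrix_det g⟩
  map_one' := Subtype.ext univMatrix_one
  map_mul' g h := Subtype.ext (univMatrix_mul g h)

/-- Representations `G → SL₂(S)` are the `S`-points of `R(G)`: this is the algebra homomorphism
`R(G) → S` sending the entries of `x_g` to the entries of `φ g`. -/
def RepRing.lift {S : Type*} [CommRing S] [Algebra ℂ S] (φ : G →* SL(2, S)) :
    RepRing G →ₐ[ℂ] S :=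
  Ideal.Quotient.liftₐ (Ideal.span (repRelations G))
    (MvPolynomial.aeval fun p : G × Fin 2 × Fin 2 => (φ p.1).1 p.2.1 p.2.2) (by
      intro a ha
      refine (Ideal.span_le (I := RingHom.ker (MvPolynomial.aeval (R := ℂ)
        fun p : G × Fin 2 × Fin 2 => (φ p.1).1 p.2.1 p.2.2))).2 ?_ ha
      have key := genMatrix_map (S := S) fun g : G => (φ g).1
      rintro q (⟨g, rfl⟩ | ⟨i, j, rfl⟩ | ⟨g, h, i, j, rfl⟩)
      · have : ((genMatrix G g).map (MvPolynomial.aeval (R := ℂ)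
            fun p : G × Fin 2 × Fin 2 => (φ p.1).1 p.2.1 p.2.2)).det = 1 := by
          rw [key]; exact (φ g).2
        simp only [SetLike.mem_coe, RingHom.mem_ker, map_sub, map_one, AlgHom.map_det,
          AlgHom.mapMatrix_apply, this, sub_self]
      · have := congrFun (congrFun (key 1) i) j
        simp only [Matrix.map_apply] at this
        simp only [SetLike.mem_coe, RingHom.mem_ker, Matrix.sub_apply, map_sub, this]
        by_cases hij : i = j <;> simp [Matrix.one_apply, hij]
      · have e := fun (k : G) (i j : Fin 2) => congrFun (congrFun (key k) i) j
        simp only [Matrix.map_apply] at e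
        simp only [SetLike.mem_coe, RingHom.mem_ker, Matrix.sub_apply, map_sub,
          Matrix.mul_apply, map_sum, map_mul, e]
        simp [Matrix.mul_apply])

@[simp]
theorem RepRing.lift_univ {S : Type*} [CommRing S] [Algebra ℂ S] (φ : G →* SL(2, S)) (g : G)
    (i j : Fin 2) : RepRing.lift φ ((univRep G g).1 i j) = (φ g).1 i j := by
  change MvPolynomial.aeval (R := ℂ) (fun p : G × Fin 2 × Fin 2 => (φ p.1).1 p.2.1 p.2.2)
    (MvPolynomial.X (g, i, j)) = _
  simp

theorem RepRing.algHom_ext {S : Type*} [CommRing S] [Algebra ℂ S] {f₁ f₂ : RepRing G →ₐ[ℂ] S}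
    (h : ∀ g i j, f₁ ((univRep G g).1 i j) = f₂ ((univRep G g).1 i j)) : f₁ = f₂ := by
  apply Ideal.Quotient.algHom_ext
  apply MvPolynomial.algHom_ext
  rintro ⟨g, i, j⟩
  exact h g i j

/-- A matrix in `SL₂(ℂ)` seen in `SL₂(S)` for a `ℂ`-algebra `S`. -/
def constSL (S : Type*) [CommRing S] [Algebra ℂ S] : SL(2, ℂ) →* SL(2, S) :=
  Matrix.SpecialLinearGroup.map (algebraMap ℂ S)

/-- The action of `A ∈ SL₂(ℂ)` on `R(G)` induced by conjugation of representations: it sends the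
entries of `x_g` to those of `A x_g A⁻¹`. -/
def conjAct (A : SL(2, ℂ)) : RepRing G →ₐ[ℂ] RepRing G :=
  RepRing.lift ((MulAut.conj (constSL (RepRing G) A)).toMonoidHom.comp (univRep G))

variable (G) in
/-- The affine character ring `χ(G) = R(G)^{SL₂(ℂ)}`. -/
def charRing : Subalgebra ℂ (RepRing G) :=
  ⨅ A : SL(2, ℂ), AlgHom.equalizer (conjAct A) (AlgHom.id ℂ (RepRing G))

theorem mem_charRing {f : RepRing G} : f ∈ charRing G ↔ ∀ A : SL(2, ℂ), conjAct A f = f := by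
  simp [charRing, Algebra.mem_iInf, AlgHom.mem_equalizer]

variable {H : Type*} [Group H]

/-- The map `R(H) → R(G)` dual to restricting representations along `h : H → G`. -/
def RepRing.map (h : H →* G) : RepRing H →ₐ[ℂ] RepRing G :=
  RepRing.lift ((univRep G).comp h)

theorem conjAct_comp_map (h : H →* G) (A : SL(2, ℂ)) :
    (conjAct A).comp (RepRing.map h) = (RepRing.map h).comp (conjAct A) := by
  apply RepRing.algHom_ext
  intro g i j
  have hc : ∀ k l, RepRing.map h ((constSL (RepRing H) A).1 k l)
      = (constSL (RepRing G) A).1 k l := by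
    intro k l
    exact (RepRing.map h).commutes _
  have hc' : ∀ k l, RepRing.map h (((constSL (RepRing H) A)⁻¹).1 k l)
      = ((constSL (RepRing G) A)⁻¹).1 k l := by
    intro k l
    rw [← map_inv, ← map_inv]
    exact (RepRing.map h).commutes _
  simp only [AlgHom.comp_apply, conjAct, RepRing.lift_univ]
  rw [RepRing.map, RepRing.lift_univ, ← RepRing.map]
  simp only [MonoidHom.comp_apply, RepRing.lift_univ, MulEquiv.coe_toMonoidHom,
    MulAut.conj_apply, Matrix.SpecialLinearGroup.coe_mul, Matrix.mul_apply, map_sum, map_mul,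
    hc, hc']
  simp only [RepRing.map, RepRing.lift_univ, MonoidHom.comp_apply]

/-- The map `χ(H) → χ(G)` induced by restricting representations along `h : H → G`. -/
def charRing.map (h : H →* G) : charRing H →ₐ[ℂ] charRing G :=
  ((RepRing.map h).comp (charRing H).val).codRestrict (charRing G) (by
    intro f
    rw [mem_charRing]
    intro A
    have e := DFunLike.congr_fun (conjAct_comp_map h A) f.1
    simp only [AlgHom.comp_apply] at e
    rw [AlgHom.comp_apply, Subalgebra.coe_val, e, mem_charRing.1 f.2 A])

end RepRing

/-! ### The torus -/

/-- The fundamental group of the torus, as the free abelian group on `λ` (first factor) and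
`μ` (second factor). -/
abbrev TorusGroup : Type := Multiplicative ℤ × Multiplicative ℤ

/-- The element `λ` of the torus group. -/
def tLong : TorusGroup := (Multiplicative.ofAdd 1, 1)

/-- The element `μ` of the torus group. -/
def tMer : TorusGroup := (1, Multiplicative.ofAdd 1)

/-- The ring of Laurent polynomials `ℂ[l, l⁻¹, m, m⁻¹]`; the monomial `l^a m^b` is
`single (a, b) 1`. -/
abbrev Laurent : Type := AddMonoidAlgebra ℂ (ℤ × ℤ)

/-- The unit `l^a m^b` of `ℂ[l, l⁻¹, m, m⁻¹]`, as a homomorphism in `(a, b)`. -/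
def monomialHom : Multiplicative (ℤ × ℤ) →* Laurentˣ :=
  (AddMonoidAlgebra.of ℂ (ℤ × ℤ)).toHomUnits

/-- The Laurent polynomial `l`, as a unit. -/
def lUnit : Laurentˣ := monomialHom (Multiplicative.ofAdd (1, 0))

/-- The Laurent polynomial `m`, as a unit. -/
def mUnit : Laurentˣ := monomialHom (Multiplicative.ofAdd (0, 1))

/-- The Laurent polynomial `l`. -/
def lVar : Laurent := lUnit

/-- Evaluation of Laurent polynomials at a point `(l, m)` of `ℂ^* × ℂ^*`. -/
def evalAt (x : ℂˣ × ℂˣ) : Laurent →ₐ[ℂ] ℂ :=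
  AddMonoidAlgebra.lift ℂ ℂ (ℤ × ℤ)
    { toFun := fun e => ((x.1 ^ e.toAdd.1 * x.2 ^ e.toAdd.2 : ℂˣ) : ℂ)
      map_one' := by simp
      map_mul' := fun a b => by
        simp only [toAdd_mul, Prod.fst_add, Prod.snd_add, zpow_add]
        push_cast
        ring }

/-- The ideal of all Laurent polynomials vanishing on a subset of `ℂ^* × ℂ^*`. -/
def vanishingIdeal (Y : Set (ℂˣ × ℂˣ)) : Ideal Laurent :=
  ⨅ x ∈ Y, RingHom.ker (evalAt x)

/-- The diagonal matrix with entries `u`, `u⁻¹`. -/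
def diagMatrix {S : Type*} [CommRing S] (u : Sˣ) : SL(2, S) :=
  ⟨!![(u : S), 0; 0, ((u⁻¹ : Sˣ) : S)], by simp⟩

/-- The diagonal matrix with entries `u`, `u⁻¹`, as a homomorphism in `u`. -/
def diagSL (S : Type*) [CommRing S] : Sˣ →* SL(2, S) where
  toFun := diagMatrix
  map_one' := by
    ext i j
    fin_cases i <;> fin_cases j <;> simp [diagMatrix]
  map_mul' u v := by
    apply Subtype.ext
    rw [Matrix.SpecialLinearGroup.coe_mul]
    ext i j
    fin_cases i <;> fin_cases j <;> simp [diagMatrix, mul_comm]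

/-- The diagonal representation of the torus group with `λ ↦ diag(u, u⁻¹)`,
`μ ↦ diag(v, v⁻¹)`. -/
def diagRep {S : Type*} [CommRing S] (u v : Sˣ) : TorusGroup →* SL(2, S) :=
  (diagSL S).comp ((zpowersHom Sˣ u).coprod (zpowersHom Sˣ v))

/-- The map dual to the map sending `(l, m)` in `ℂ^* × ℂ^*` to the character of the representation
`λ ↦ diag(l, l⁻¹)`, `μ ↦ diag(m, m⁻¹)`. -/
def pHat : charRing TorusGroup →ₐ[ℂ] Laurent :=
  (RepRing.lift (diagRep lUnit mUnit)).comp (charRing TorusGroup).val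

/-! ### Knots -/

/-- The unit sphere in `ℝ⁴`. -/
abbrev S3 : Type := Metric.sphere (0 : EuclideanSpace ℝ (Fin 4)) 1

/-- The closed unit disc. -/
abbrev Disc : Type := Metric.closedBall (0 : ℂ) 1

/-- A point of the boundary circle as a point of the disc. -/
def bdry (z : Circle) : Disc := ⟨z, by rw [mem_closedBall_zero_iff, Circle.norm_coe]⟩

/-- The centre of the disc. -/
def centre : Disc := ⟨0, by simp⟩

theorem continuous_bdry : Continuous bdry := by
  unfold bdry
  fun_prop

/-- A (tame) knot in `S³` together with a parametrized closed tubular neighbourhood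
`Circle × Disc → S³`; the knot itself is the image of `Circle × {0}`. -/
structure FramedKnot where
  nbhd : C(Circle × Disc, S3)
  injective : Function.Injective nbhd

namespace FramedKnot

variable (K : FramedKnot)

/-- The knot as a subset of `S³`. -/
def carrier : Set S3 := Set.range fun z : Circle => K.nbhd (z, centre)

/-- The complement of the knot. -/
abbrev Compl : Type := {x : S3 // x ∉ K.carrier}

/-- The inclusion of the boundary torus of the tubular neighbourhood into the complement. -/
def torus : C(Circle × Circle, K.Compl) where
  toFun p := ⟨K.nbhd (p.1, bdry p.2), by
    rintro ⟨z, hz⟩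
    have h := congrArg (fun q : Circle × Disc => (q.2 : ℂ)) (K.injective hz)
    simp only [bdry, centre] at h
    exact Circle.coe_ne_zero p.2 h.symm⟩
  continuous_toFun := by
    refine Continuous.subtype_mk (K.nbhd.continuous.comp ?_) _
    exact continuous_fst.prodMk (continuous_bdry.comp continuous_snd)

/-- The base point, on the boundary torus. -/
def base : K.Compl := K.torus (1, 1)

/-- The knot group, the fundamental group of the complement. -/
abbrev KnotGroup : Type := FundamentalGroup K.Compl K.base

end FramedKnot

/-- The standard loop `t ↦ exp(2πit)` in the circle. -/
def circleLoop : Path (1 : Circle) 1 where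
  toFun t := Circle.exp (2 * Real.pi * t)
  continuous_toFun := by fun_prop
  source' := by simp
  target' := by simp

/-- The class of the loop `Circle × {1}` in the fundamental group of the torus. -/
def torusLong : FundamentalGroup (Circle × Circle) (1, 1) :=
  FundamentalGroup.fromPath (Path.Homotopic.Quotient.mk (circleLoop.prod (Path.refl 1)))

/-- The class of the loop `{1} × Circle` in the fundamental group of the torus. -/
def torusMer : FundamentalGroup (Circle × Circle) (1, 1) :=
  FundamentalGroup.fromPath (Path.Homotopic.Quotient.mk ((Path.refl 1).prod circleLoop))

theorem torus_commute : Commute torusLong torusMer := by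
  have h1 : torusLong = Path.Homotopic.prod (Path.Homotopic.Quotient.mk circleLoop)
      (Path.Homotopic.Quotient.refl 1) := rfl
  have h2 : torusMer = Path.Homotopic.prod (Path.Homotopic.Quotient.refl 1)
      (Path.Homotopic.Quotient.mk circleLoop) := rfl
  change torusLong * torusMer = torusMer * torusLong
  rw [FundamentalGroup.mul_def, FundamentalGroup.mul_def, h1, h2]
  erw [Path.Homotopic.comp_prod_eq_prod_comp, Path.Homotopic.comp_prod_eq_prod_comp]
  simp

namespace FramedKnot

variable (K : FramedKnot)

/-- The longitude of the tubular neighbourhood, an element of the knot group. -/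
def longitude : K.KnotGroup := FundamentalGroup.map K.torus (1, 1) torusLong

/-- The meridian of the tubular neighbourhood, an element of the knot group. -/
def meridian : K.KnotGroup := FundamentalGroup.map K.torus (1, 1) torusMer

theorem commute_longitude_meridian : Commute K.longitude K.meridian :=
  torus_commute.map (FundamentalGroup.map K.torus (1, 1))

/-- The homomorphism from the torus group to the knot group with `λ ↦` longitude and
`μ ↦` meridian, induced by the inclusion of the boundary torus. Its range is the peripheral
subgroup. -/
def peripheral : TorusGroup →* K.KnotGroup :=
  (zpowersHom K.KnotGroup K.longitude).noncommCoprod (zpowersHom K.KnotGroup K.meridian)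
    fun a b => by
      simpa only [zpowersHom_apply] using
        (K.commute_longitude_meridian.zpow_zpow a.toAdd b.toAdd)

end FramedKnot

/-- A knot in `S³` with a tubular neighbourhood whose longitude is the preferred one: it is
null-homologous in the complement, that is, its class lies in the commutator subgroup of the
knot group. -/
structure Knot extends FramedKnot where
  preferred : toFramedKnot.longitude ∈ commutator toFramedKnot.KnotGroup

namespace Knot

variable (K : Knot)

/-- The kernel of the restriction map from the affine characters of the torus to those of
the knot group. -/
def peripheralIdeal : Ideal (charRing TorusGroup) :=
  RingHom.ker (charRing.map K.peripheral)

/-- The pairs of upper diagonal entries of the images of the longitude and the meridian under the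
representations of the knot group in `SL₂(ℂ)` that send the peripheral subgroup to upper
triangular matrices. -/
def eigenvalueSet : Set (ℂˣ × ℂˣ) :=
  {x | ∃ φ : K.KnotGroup →* SL(2, ℂ), (∀ g, (φ (K.peripheral g)).1 1 0 = 0) ∧
    (x.1 : ℂ) = (φ K.longitude).1 0 0 ∧ (x.2 : ℂ) = (φ K.meridian).1 0 0}

/-- The same pairs, for the representations that send the peripheral subgroup to diagonal
matrices. -/
def diagonalSet : Set (ℂˣ × ℂˣ) :=
  {x | ∃ φ : K.KnotGroup →* SL(2, ℂ),
    (∀ g, (φ (K.peripheral g)).1 1 0 = 0 ∧ (φ (K.peripheral g)).1 0 1 = 0) ∧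
    (x.1 : ℂ) = (φ K.longitude).1 0 0 ∧ (x.2 : ℂ) = (φ K.meridian).1 0 0}

/-- `B` is a generator of the ideal of the eigenvalue curve of `K`. -/
def IsBPolynomial (B : Laurent) : Prop :=
  vanishingIdeal K.eigenvalueSet = Ideal.span {B}

/-- `A` is an A-polynomial of `K`: `(l - 1) A` generates the ideal of the eigenvalue curve of `K`,
and `l - 1` does not divide `A`. -/
def IsAPolynomial (A : Laurent) : Prop :=
  K.IsBPolynomial ((lVar - 1) * A) ∧ ¬ (lVar - 1) ∣ A

end Knot

end AffineChar

end

/-! Everything follows from `Knot.radical_map_pHat`, which needs no B-polynomial: the radical of the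
ideal generated by the image of `peripheralIdeal` is the vanishing ideal of the eigenvalue set Y.

The value of an invariant at an upper triangular representation depends only on the diagonal
(`lift_eq_of_upper`), and every representation of the torus group is conjugate to an upper
triangular one. So `pHat f` vanishes on Y exactly when the restriction of `f` vanishes at all
representations of the knot group (`pHat_mem_vanishingIdeal_iff`), which gives one inclusion.
Conversely, such a restriction is nilpotent by a Nullstellensatz in continuum many variables, so a
power of `f` lies in the kernel. This settles the image of `pHat`, which contains all Laurent
polynomials symmetric under inverting l and m. Since Y is stable under inversion, a general h
vanishing on Y is a root of a monic quadratic whose other coefficients, h + h' and hh' with h' the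
inverted h, are symmetric and vanish on Y.

Points of Y outside the diagonal set have coordinates ±1, so l² - 1 and m² - 1 vanish there. These
two are coprime, hence a principal vanishing ideal is unchanged by dropping such points. Uniqueness
of A is cancellation of l - 1. -/

/-! ### A Nullstellensatz in continuum many variables -/

open Cardinal in
/-- A field of cardinality at most the continuum over a countable subfield of `ℂ` embeds
into `ℂ`. -/
theorem Complex.nonempty_algHom_of_mk_le_continuum (k : Subfield ℂ) [Countable k]
    (F : Type) [Field F] [Algebra k F] (hF : #F ≤ 𝔠) : Nonempty (F →ₐ[k] ℂ) := by
  obtain ⟨s, hs⟩ := exists_isTranscendenceBasis k F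
  obtain ⟨t, ht⟩ := exists_isTranscendenceBasis k ℂ
  -- Since `k` is countable and ℂ is not, the transcendence basis has the full cardinality of ℂ,
  -- which leaves room for `s`.
  have htc : #ℂ = #t :=
    IsAlgClosed.cardinal_eq_cardinal_transcendence_basis_of_aleph0_lt' _ ht
      (Cardinal.mk_le_aleph0 (α := k)) (by rw [Cardinal.mk_complex]; exact aleph0_lt_continuum)
  have hst : #s ≤ #t := by
    rw [← htc, Cardinal.mk_complex]
    exact (mk_set_le s).trans hF
  obtain ⟨e⟩ := Cardinal.le_def _ _ |>.1 hst
  let f : Algebra.adjoin k (Set.range ((↑) : s → F)) →ₐ[k] ℂ :=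
    (MvPolynomial.aeval fun i : s => (e i : ℂ)).comp hs.1.aevalEquiv.symm.toAlgHom
  have hf : Function.Injective f := by
    refine Function.Injective.comp (g := MvPolynomial.aeval fun i : s => (e i : ℂ)) ?_
      hs.1.aevalEquiv.symm.injective
    exact (ht.1.comp e e.injective)
  -- Through `f`, ℂ becomes an algebra over the subalgebra generated by `s`; as `F` is algebraic
  -- over that subalgebra, `f` extends to `F`.
  let := f.toRingHom.toAlgebra
  have : FaithfulSMul (Algebra.adjoin k (Set.range ((↑) : s → F))) ℂ :=
    (faithfulSMul_iff_algebraMap_injective _ _).2 hf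
  have : Algebra.IsAlgebraic (Algebra.adjoin k (Set.range ((↑) : s → F))) F := hs.isAlgebraic
  have : IsScalarTower k (Algebra.adjoin k (Set.range ((↑) : s → F))) ℂ :=
    IsScalarTower.of_algebraMap_eq fun x => (f.commutes x).symm
  exact ⟨(IsAlgClosed.lift (R := Algebra.adjoin k (Set.range ((↑) : s → F))) (S := F)
    (M := ℂ)).restrictScalars k⟩

/-- Nullstellensatz for ideals of `ℂ[X_i]` generated by polynomials with integer coefficients,
in at most continuum many variables. -/
theorem MvPolynomial.mem_radical_span_map_int {σ : Type} (hσ : Cardinal.mk σ ≤ Cardinal.continuum)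
    (S : Set (MvPolynomial σ ℤ)) (f : MvPolynomial σ ℂ)
    (hf : ∀ x : σ → ℂ, (∀ q ∈ S, aeval x q = 0) → aeval x f = 0) :
    f ∈ (Ideal.span (map (Int.castRingHom ℂ) '' S)).radical := by
  classical
  -- A countable field of definition for `f`; the integral equations in `S` are defined over it as
  -- well.
  let k : Subfield ℂ := Subfield.closure (f.coeffs : Set ℂ)
  have : Countable k := by
    rw [← Cardinal.mk_le_aleph0_iff]
    refine (Subfield.cardinalMk_closure_le_max _).trans (max_le ?_ le_rfl)
    exact (Set.Finite.countable (Finset.finite_toSet f.coeffs)).le_aleph0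
  obtain ⟨f₀, hf₀⟩ : ∃ f₀ : MvPolynomial σ k, map (algebraMap k ℂ) f₀ = f := by
    have : f ∈ Set.range (map (σ := σ) (algebraMap k ℂ)) := by
      rw [mem_range_map_iff_coeffs_subset]
      intro c hc
      exact ⟨⟨c, Subfield.subset_closure hc⟩, rfl⟩
    exact this
  let J₀ : Ideal (MvPolynomial σ k) := Ideal.span (map (Int.castRingHom k) '' S)
  by_cases hJ : f₀ ∈ J₀.radical
  · obtain ⟨n, hn⟩ := hJ
    refine ⟨n, ?_⟩
    have h := Ideal.mem_map_of_mem (map (σ := σ) (algebraMap k ℂ)) hn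
    rw [map_pow, hf₀, Ideal.map_span, Set.image_image] at h
    convert h using 4 with q
    rw [map_map]
    congr 1
  -- Some prime `P` over the equations misses `f₀`; embedding its residue field in ℂ yields a common
  -- zero of `S` at which `f` does not vanish.
  · rw [Ideal.radical_eq_sInf, Ideal.mem_sInf] at hJ
    push Not at hJ
    obtain ⟨P, ⟨hJP, hP⟩, hfP⟩ := hJ
    let F := FractionRing (MvPolynomial σ k ⧸ P)
    have hF : Cardinal.mk F ≤ Cardinal.continuum := by
      rw [IsFractionRing.cardinalMk (MvPolynomial σ k ⧸ P) F]
      refine (Cardinal.mk_le_of_surjective Ideal.Quotient.mk_surjective).trans ?_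
      refine MvPolynomial.cardinalMk_le_max.trans (max_le (max_le ?_ hσ) ?_)
      · exact Cardinal.mk_le_aleph0.trans Cardinal.aleph0_le_continuum
      · exact Cardinal.aleph0_le_continuum
    obtain ⟨e⟩ := Complex.nonempty_algHom_of_mk_le_continuum k F hF
    let g : MvPolynomial σ k →ₐ[k] ℂ :=
      (e.comp (IsScalarTower.toAlgHom k (MvPolynomial σ k ⧸ P) F)).comp (Ideal.Quotient.mkₐ k P)
    have hker : ∀ p, g p = 0 ↔ p ∈ P := by
      intro p
      rw [← Ideal.Quotient.eq_zero_iff_mem]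
      change e (algebraMap _ F (Ideal.Quotient.mk P p)) = 0 ↔ _
      rw [map_eq_zero_iff e e.toRingHom.injective]
      exact IsFractionRing.to_map_eq_zero_iff (R := MvPolynomial σ k ⧸ P) (K := F)
    let x : σ → ℂ := fun i => g (X i)
    have hg : g = aeval x := by
      apply algHom_ext
      intro i
      simp [x]
    exfalso
    apply hfP
    rw [← hker, hg]
    have h1 : aeval x f = 0 := by
      apply hf
      intro q hq
      have h2 : g (map (Int.castRingHom k) q) = 0 :=
        (hker _).2 (hJP (Ideal.subset_span ⟨q, hq, rfl⟩))
      rw [hg] at h2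
      rw [← h2, aeval_def, aeval_def, eval₂_map]
      congr 1
    rw [← hf₀] at h1
    rw [← h1, aeval_def, aeval_def, eval₂_map]
    rfl

/-! ### Nilpotents of the representation ring, and the size of knot groups -/

noncomputable section
namespace AffineChar

section Nullstellensatz

variable (G : Type) [Group G]

/-- The generic matrix with integer coefficients attached to `g`. -/
def intMatrix (g : G) : Matrix (Fin 2) (Fin 2) (MvPolynomial (G × Fin 2 × Fin 2) ℤ) :=
  Matrix.of fun i j => MvPolynomial.X (g, i, j)

/-- The defining relations of `R(G)`, over the integers. -/
def intRelations : Set (MvPolynomial (G × Fin 2 × Fin 2) ℤ) :=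
  {q | (∃ g, q = (intMatrix G g).det - 1) ∨
    (∃ i j, q = (intMatrix G 1 - 1) i j) ∨
    ∃ g h i j, q = (intMatrix G (g * h) - intMatrix G g * intMatrix G h) i j}

omit [Group G] in
theorem map_intMatrix_apply (g : G) (i j : Fin 2) :
    MvPolynomial.map (Int.castRingHom ℂ) (intMatrix G g i j) = genMatrix G g i j := by
  simp [intMatrix, genMatrix]

theorem repRelations_subset_map_intRelations :
    repRelations G ⊆ MvPolynomial.map (Int.castRingHom ℂ) '' intRelations G := by
  rintro q (⟨g, rfl⟩ | ⟨i, j, rfl⟩ | ⟨g, h, i, j, rfl⟩)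
  · refine ⟨_, Or.inl ⟨g, rfl⟩, ?_⟩
    simp only [Matrix.det_fin_two, map_sub, map_mul, map_one, map_intMatrix_apply]
  · refine ⟨_, Or.inr (Or.inl ⟨i, j, rfl⟩), ?_⟩
    by_cases hij : i = j <;>
      simp [Matrix.sub_apply, map_intMatrix_apply, hij]
  · refine ⟨_, Or.inr (Or.inr ⟨g, h, i, j, rfl⟩), ?_⟩
    simp only [Matrix.sub_apply, Matrix.mul_apply, map_sub, map_sum, map_mul,
      map_intMatrix_apply]

theorem map_intRelations_subset_repRelations :
    MvPolynomial.map (Int.castRingHom ℂ) '' intRelations G ⊆ repRelations G := by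
  rintro _ ⟨q, ⟨g, rfl⟩ | ⟨i, j, rfl⟩ | ⟨g, h, i, j, rfl⟩, rfl⟩
  · refine Or.inl ⟨g, ?_⟩
    simp only [Matrix.det_fin_two, map_sub, map_mul, map_one, map_intMatrix_apply]
  · refine Or.inr (Or.inl ⟨i, j, ?_⟩)
    by_cases hij : i = j <;>
      simp [Matrix.sub_apply, map_intMatrix_apply, hij]
  · refine Or.inr (Or.inr ⟨g, h, i, j, ?_⟩)
    simp only [Matrix.sub_apply, Matrix.mul_apply, map_sub, map_sum, map_mul,
      map_intMatrix_apply]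

variable {G}

/-- For a group with at most continuum many elements, an element of `R(G)` that vanishes at all
representations of `G` in `SL₂(ℂ)` is nilpotent. -/
theorem RepRing.isNilpotent_of_forall_lift_eq_zero (hG : Cardinal.mk G ≤ Cardinal.continuum)
    (f : RepRing G) (hf : ∀ φ : G →* SL(2, ℂ), RepRing.lift φ f = 0) : IsNilpotent f := by
  obtain ⟨f, rfl⟩ := Ideal.Quotient.mk_surjective f
  have hσ : Cardinal.mk (G × Fin 2 × Fin 2) ≤ Cardinal.continuum := by
    simp only [Cardinal.mk_prod, Cardinal.lift_id, Cardinal.mk_fin]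
    refine Cardinal.mul_le_of_le Cardinal.aleph0_le_continuum hG ?_
    exact_mod_cast (Cardinal.natCast_lt_aleph0 (n := 4)).le.trans Cardinal.aleph0_le_continuum
  have h := MvPolynomial.mem_radical_span_map_int hσ (intRelations G) f ?_
  · rw [Set.Subset.antisymm (map_intRelations_subset_repRelations G)
      (repRelations_subset_map_intRelations G)] at h
    obtain ⟨n, hn⟩ := h
    exact ⟨n, by rw [← map_pow]; exact Ideal.Quotient.eq_zero_iff_mem.2 hn⟩
  · intro x hx
    let M : G → Matrix (Fin 2) (Fin 2) ℂ := fun g => Matrix.of fun i j => x (g, i, j)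
    have hM : ∀ g i j, MvPolynomial.aeval x (intMatrix G g i j) = M g i j := by
      intro g i j
      simp [intMatrix, M]
    let φ : G →* SL(2, ℂ) :=
      { toFun := fun g => ⟨M g, by
          have := hx _ (Or.inl ⟨g, rfl⟩)
          simp only [Matrix.det_fin_two, map_sub, map_mul, map_one, hM] at this
          rw [Matrix.det_fin_two]
          exact sub_eq_zero.1 this⟩
        map_one' := by
          ext i j
          have := hx _ (Or.inr (Or.inl ⟨i, j, rfl⟩))
          rw [Matrix.sub_apply, map_sub, hM, sub_eq_zero] at this
          refine this.trans ?_
          by_cases hij : i = j <;> simp [Matrix.one_apply, hij]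
        map_mul' := fun g h => by
          ext i j
          have := hx _ (Or.inr (Or.inr ⟨g, h, i, j, rfl⟩))
          simp only [Matrix.sub_apply, Matrix.mul_apply, map_sub, map_sum, map_mul, hM,
            sub_eq_zero] at this
          exact this.trans (Matrix.mul_apply (M := M g) (N := M h)).symm }
    exact hf φ

end Nullstellensatz

-- A point is determined by the basic open sets containing it, and a countable basis has at most
-- continuum many subsets.
open Cardinal in
theorem mk_le_continuum_of_secondCountable (Y : Type) [TopologicalSpace Y] [T0Space Y]
    [SecondCountableTopology Y] : #Y ≤ 𝔠 := by
  let b := TopologicalSpace.countableBasis Y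
  have hb := TopologicalSpace.isBasis_countableBasis Y
  have hinj : Function.Injective fun y : Y => {U : b | y ∈ U.1} := by
    intro y z h
    refine (hb.inseparable_iff.2 fun U hU => ?_).eq
    exact Set.ext_iff.1 h ⟨U, hU⟩
  refine (Cardinal.mk_le_of_injective hinj).trans ?_
  rw [Cardinal.mk_set, ← Cardinal.two_power_aleph0]
  exact Cardinal.power_le_power_left two_ne_zero
    (TopologicalSpace.countable_countableBasis Y).le_aleph0

open Cardinal in
/-- The fundamental group of a second countable Hausdorff space has at most continuum many
elements. -/
theorem mk_fundamentalGroup_le_continuum (X : Type) [TopologicalSpace X] [T2Space X]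
    [SecondCountableTopology X] (x : X) : #(FundamentalGroup X x) ≤ 𝔠 := by
  have h1 : #(Path x x) ≤ 𝔠 := by
    -- The compact-open topology on maps from the interval to `X` is again Hausdorff and second
    -- countable.
    refine (Cardinal.mk_le_of_injective (f := fun p : Path x x => p.toContinuousMap) ?_).trans
      (mk_le_continuum_of_secondCountable _)
    intro p q h
    ext t
    exact DFunLike.congr_fun h t
  exact (Cardinal.mk_le_of_surjective (f := fun p : Path x x =>
    FundamentalGroup.fromPath (Path.Homotopic.Quotient.mk p)) Quotient.mk_surjective).trans h1

theorem FramedKnot.mk_knotGroup_le_continuum (K : FramedKnot) :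
    Cardinal.mk K.KnotGroup ≤ Cardinal.continuum :=
  mk_fundamentalGroup_le_continuum _ _

end AffineChar
end

/-! ### Values of invariants at upper triangular representations -/

noncomputable section
namespace AffineChar

section Points

variable {G : Type*} [Group G] {H : Type*} [Group H]

/-- The conjugate of a representation by an element of `SL₂`. -/
def conjRep {S : Type*} [CommRing S] (A : SL(2, S)) (φ : G →* SL(2, S)) : G →* SL(2, S) :=
  (MulAut.conj A).toMonoidHom.comp φ

@[simp]
theorem conjRep_apply {S : Type*} [CommRing S] (A : SL(2, S)) (φ : G →* SL(2, S)) (g : G) :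
    conjRep A φ g = A * φ g * A⁻¹ := rfl

/-- Restriction, conjugation and specialization of parameters are all compared through this
principle: it suffices to check matrix entries. -/
theorem algHom_lift {S S' : Type*} [CommRing S] [Algebra ℂ S] [CommRing S'] [Algebra ℂ S']
    (α : S →ₐ[ℂ] S') {φ : G →* SL(2, S)} {φ' : G →* SL(2, S')}
    (h : ∀ g i j, α ((φ g).1 i j) = (φ' g).1 i j) (f : RepRing G) :
    α (RepRing.lift φ f) = RepRing.lift φ' f := by
  have : α.comp (RepRing.lift φ) = RepRing.lift φ' := by
    apply RepRing.algHom_ext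
    intro g i j
    simp [h]
  exact DFunLike.congr_fun this f

theorem lift_map (h : H →* G) (φ : G →* SL(2, ℂ)) (f : RepRing H) :
    RepRing.lift φ (RepRing.map h f) = RepRing.lift (φ.comp h) f :=
  algHom_lift _ (fun g i j => by simp) f

theorem lift_conjAct (A : SL(2, ℂ)) (φ : G →* SL(2, ℂ)) (f : RepRing G) :
    RepRing.lift φ (conjAct A f) = RepRing.lift (conjRep A φ) f := by
  refine algHom_lift _ (fun g i j => ?_) f
  have hc : ∀ k l, RepRing.lift φ ((constSL (RepRing G) A).1 k l) = A.1 k l := fun k l =>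
    (RepRing.lift φ).commutes _
  have hc' : ∀ k l, RepRing.lift φ (((constSL (RepRing G) A)⁻¹).1 k l) = A⁻¹.1 k l := by
    intro k l
    rw [← map_inv]
    exact (RepRing.lift φ).commutes _
  simp only [MonoidHom.comp_apply, MulEquiv.coe_toMonoidHom, MulAut.conj_apply, conjRep_apply,
    Matrix.SpecialLinearGroup.coe_mul, Matrix.mul_apply, map_sum, map_mul, hc, hc',
    RepRing.lift_univ]

theorem lift_conjRep (A : SL(2, ℂ)) (φ : G →* SL(2, ℂ)) {f : RepRing G} (hf : f ∈ charRing G) :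
    RepRing.lift (conjRep A φ) f = RepRing.lift φ f := by
  rw [← lift_conjAct, mem_charRing.1 hf A]

section Upper

variable {φ : G →* SL(2, ℂ)} (hφ : ∀ g, (φ g).1 1 0 = 0)
include hφ

theorem upper_mul_eq_one (g : G) : (φ g).1 0 0 * (φ g).1 1 1 = 1 := by
  have := (φ g).2
  rw [Matrix.det_fin_two, hφ] at this
  simpa using this

theorem upper_mul_zero_zero (g h : G) :
    (φ (g * h)).1 0 0 = (φ g).1 0 0 * (φ h).1 0 0 := by
  rw [map_mul, Matrix.SpecialLinearGroup.coe_mul, Matrix.mul_apply, Fin.sum_univ_two, hφ h]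
  ring

omit hφ in
theorem upper_mul_zero_one (g h : G) :
    (φ (g * h)).1 0 1 = (φ g).1 0 0 * (φ h).1 0 1 + (φ g).1 0 1 * (φ h).1 1 1 := by
  rw [map_mul, Matrix.SpecialLinearGroup.coe_mul, Matrix.mul_apply, Fin.sum_univ_two]

theorem upper_mul_one_one (g h : G) :
    (φ (g * h)).1 1 1 = (φ g).1 1 1 * (φ h).1 1 1 := by
  rw [map_mul, Matrix.SpecialLinearGroup.coe_mul, Matrix.mul_apply, Fin.sum_univ_two, hφ g]
  ring

end Upper

/-- The upper left entry of an upper triangular representation, as a homomorphism. -/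
def upperEntry (φ : G →* SL(2, ℂ)) (hφ : ∀ g, (φ g).1 1 0 = 0) : G →* ℂ where
  toFun g := (φ g).1 0 0
  map_one' := by simp
  map_mul' := upper_mul_zero_zero hφ

open Polynomial in
/-- The family of representations obtained from an upper triangular one by multiplying the
off-diagonal entry by a parameter. -/
def scaleRep (φ : G →* SL(2, ℂ)) (hφ : ∀ g, (φ g).1 1 0 = 0) : G →* SL(2, ℂ[X]) where
  toFun g := ⟨!![C ((φ g).1 0 0), C ((φ g).1 0 1) * X; 0, C ((φ g).1 1 1)], by
    rw [Matrix.det_fin_two]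
    simp [← C_mul, upper_mul_eq_one hφ]⟩
  map_one' := by
    ext i j
    fin_cases i <;> fin_cases j <;> simp
  map_mul' g h := by
    apply Subtype.ext
    refine Eq.trans ?_ (Matrix.SpecialLinearGroup.coe_mul _ _).symm
    simp only [upper_mul_zero_zero hφ, upper_mul_zero_one (φ := φ), upper_mul_one_one hφ,
      Matrix.mul_fin_two]
    simp only [C_mul, C_add]
    refine Matrix.ext fun i j => ?_
    fin_cases i <;> fin_cases j <;> simp <;> ring

open Polynomial in
theorem scaleRep_val (φ : G →* SL(2, ℂ)) (hφ : ∀ g, (φ g).1 1 0 = 0) (g : G) :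
    (scaleRep φ hφ g).1 =
      !![C ((φ g).1 0 0), C ((φ g).1 0 1) * X; 0, C ((φ g).1 1 1)] := rfl

theorem diagSL_val {S : Type*} [CommRing S] (u : Sˣ) :
    (diagSL S u).1 = !![(u : S), 0; 0, ((u⁻¹ : Sˣ) : S)] := rfl

open Polynomial in
/-- An invariant takes the same value at every member of the family `scaleRep`. -/
theorem lift_scaleRep {φ : G →* SL(2, ℂ)} (hφ : ∀ g, (φ g).1 1 0 = 0) {f : RepRing G}
    (hf : f ∈ charRing G) : RepRing.lift (scaleRep φ hφ) f = C (RepRing.lift φ f) := by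
  have key : ∀ z : ℂ, z ≠ 0 →
      (RepRing.lift (scaleRep φ hφ) f).eval z = RepRing.lift φ f := by
    intro z hz
    -- Conjugation by diag(s, s⁻¹) multiplies the upper right entry by s².
    obtain ⟨s, rfl⟩ := IsAlgClosed.exists_pow_nat_eq z (n := 2) two_pos
    have hs : s ≠ 0 := by rintro rfl; simp at hz
    rw [← lift_conjRep (diagSL ℂ (Units.mk0 s hs)) φ hf]
    rw [← Polynomial.coe_aeval_eq_eval]
    refine algHom_lift (Polynomial.aeval (R := ℂ) (s ^ 2)) (fun g i j => ?_) f
    simp only [conjRep_apply, ← map_inv, Matrix.SpecialLinearGroup.coe_mul, scaleRep_val,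
      diagSL_val, Matrix.mul_apply, Fin.sum_univ_two]
    have := hφ g
    fin_cases i <;> fin_cases j <;>
      simp [this] <;> field_simp
  -- The factor `X` absorbs the parameter 0, which conjugation does not reach.
  have h : X * (RepRing.lift (scaleRep φ hφ) f - C (RepRing.lift φ f)) = 0 := by
    apply Polynomial.funext
    intro z
    by_cases hz : z = 0
    · simp [hz]
    · simp [key z hz]
  exact sub_eq_zero.1 ((mul_eq_zero.1 h).resolve_left X_ne_zero)

/-- The value of an invariant at an upper triangular representation depends only on the diagonal. -/
theorem lift_eq_of_upper {φ φ' : G →* SL(2, ℂ)} (hφ : ∀ g, (φ g).1 1 0 = 0)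
    (hφ' : ∀ g, (φ' g).1 1 0 = 0) (h : ∀ g, (φ g).1 0 0 = (φ' g).1 0 0) {f : RepRing G}
    (hf : f ∈ charRing G) : RepRing.lift φ f = RepRing.lift φ' f := by
  have h11 : ∀ g, (φ g).1 1 1 = (φ' g).1 1 1 := by
    intro g
    have h1 := upper_mul_eq_one hφ g
    have h2 := upper_mul_eq_one hφ' g
    rw [← h g] at h2
    exact mul_left_cancel₀ (left_ne_zero_of_mul_eq_one h1) (h1.trans h2.symm)
  -- At parameter 0 both families specialize to the same diagonal representation.
  have h1 := congrArg (Polynomial.aeval (R := ℂ) (0 : ℂ)) (lift_scaleRep hφ hf)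
  have h2 := congrArg (Polynomial.aeval (R := ℂ) (0 : ℂ)) (lift_scaleRep hφ' hf)
  rw [Polynomial.aeval_C] at h1 h2
  let α : Polynomial ℂ →ₐ[ℂ] ℂ := Polynomial.aeval 0
  let ψ : G →* SL(2, ℂ) := (Matrix.SpecialLinearGroup.map α.toRingHom).comp (scaleRep φ' hφ')
  rw [algHom_lift α (φ' := ψ)] at h1 h2
  · exact h1.symm.trans h2
  · intro g i j
    rfl
  · intro g i j
    change α _ = α _
    rw [scaleRep_val, scaleRep_val, h, h11]
    fin_cases i <;> fin_cases j <;> simp [α]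

end Points

section Torus

theorem evalAt_single (x : ℂˣ × ℂˣ) (a b : ℤ) (c : ℂ) :
    evalAt x (AddMonoidAlgebra.single (a, b) c) = c * ((x.1 ^ a * x.2 ^ b : ℂˣ) : ℂ) := by
  simp [evalAt, AddMonoidAlgebra.lift_single]

theorem monomialHom_zpow (a b : ℤ) :
    ((lUnit ^ a * mUnit ^ b : Laurentˣ) : Laurent) = AddMonoidAlgebra.single (a, b) 1 := by
  rw [lUnit, mUnit, ← map_zpow monomialHom, ← map_zpow monomialHom, ← map_mul]
  simp [monomialHom, ← ofAdd_zsmul, ← ofAdd_add]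

theorem diagRep_apply {S : Type*} [CommRing S] (u v : Sˣ) (g : TorusGroup) :
    diagRep u v g = diagSL S (u ^ g.1.toAdd * v ^ g.2.toAdd) := by
  simp [diagRep, zpowersHom_apply]

theorem evalAt_pHat (x : ℂˣ × ℂˣ) (f : charRing TorusGroup) :
    evalAt x (pHat f) = RepRing.lift (diagRep x.1 x.2) f.1 := by
  refine algHom_lift _ (fun g i j => ?_) f.1
  have h : ∀ a b : ℤ, evalAt x ((lUnit ^ a * mUnit ^ b : Laurentˣ) : Laurent) =
      ((x.1 ^ a * x.2 ^ b : ℂˣ) : ℂ) := by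
    intro a b
    rw [monomialHom_zpow, evalAt_single, one_mul]
  rw [diagRep_apply, diagRep_apply, diagSL_val, diagSL_val]
  generalize ha : g.1.toAdd = a
  generalize hb : g.2.toAdd = b
  have h' := h (-a) (-b)
  rw [zpow_neg, zpow_neg, zpow_neg, zpow_neg, ← mul_inv, ← mul_inv] at h'
  fin_cases i <;> fin_cases j <;>
    simp only [Matrix.of_apply,
      Matrix.cons_val', Matrix.cons_val_zero, Matrix.cons_val_one, Fin.zero_eta, Fin.mk_one,
      Matrix.cons_val_fin_one, map_zero, h, h']

theorem torus_decomp (g : TorusGroup) : g = tLong ^ g.1.toAdd * tMer ^ g.2.toAdd := by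
  ext <;> simp [tLong, tMer, ← ofAdd_zsmul]

/-- The value of an invariant at an upper triangular representation of the torus group is given by
`pHat`. -/
theorem lift_eq_evalAt_pHat {φ : TorusGroup →* SL(2, ℂ)} (hφ : ∀ g, (φ g).1 1 0 = 0)
    {x : ℂˣ × ℂˣ} (h1 : (x.1 : ℂ) = (φ tLong).1 0 0) (h2 : (x.2 : ℂ) = (φ tMer).1 0 0)
    (f : charRing TorusGroup) : RepRing.lift φ f.1 = evalAt x (pHat f) := by
  rw [evalAt_pHat]
  refine lift_eq_of_upper hφ (fun g => ?_) (fun g => ?_) f.2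
  · rw [diagRep_apply, diagSL_val]
    simp
  · have e1 : (φ g).1 0 0 = upperEntry φ hφ g := rfl
    have e2 : (diagRep x.1 x.2 g).1 0 0 = ((x.1 ^ g.1.toAdd * x.2 ^ g.2.toAdd : ℂˣ) : ℂ) := by
      rw [diagRep_apply]; rfl
    -- The upper left entry is a character, so its values on the two generators determine it.
    have u1 : (upperEntry φ hφ).toHomUnits tLong = x.1 := Units.ext h1.symm
    have u2 : (upperEntry φ hφ).toHomUnits tMer = x.2 := Units.ext h2.symm
    rw [e1, e2, ← MonoidHom.coe_toHomUnits, ← u1, ← u2, ← map_zpow, ← map_zpow, ← map_mul,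
      ← torus_decomp]

end Torus

end AffineChar
end

/-! ### Triangularization and the eigenvalue set -/

noncomputable section
namespace AffineChar

section Triangular

theorem exists_quadratic_root {a : ℂ} (ha : a ≠ 0) (b c : ℂ) : ∃ z, a * z ^ 2 + b * z + c = 0 := by
  obtain ⟨s, hs⟩ := IsAlgClosed.exists_pow_nat_eq (discrim a b c) (n := 2) two_pos
  obtain ⟨z, hz⟩ := exists_quadratic_eq_zero ha ⟨s, by rw [← hs, sq]⟩
  exact ⟨z, by rw [sq]; exact hz⟩

/-- A unipotent upper triangular matrix. -/
def upperUnip (s : ℂ) : SL(2, ℂ) := ⟨!![1, s; 0, 1], by simp⟩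

/-- The matrix `[0, 1; -1, z]`. -/
def flipMatrix (z : ℂ) : SL(2, ℂ) := ⟨!![0, 1; -1, z], by simp⟩

theorem conj_upperUnip_val (s : ℂ) (M : SL(2, ℂ)) :
    (upperUnip s * M * (upperUnip s)⁻¹).1 =
      !![M.1 0 0 + s * M.1 1 0,
        -(M.1 0 0 + s * M.1 1 0) * s + (M.1 0 1 + s * M.1 1 1);
        M.1 1 0, -M.1 1 0 * s + M.1 1 1] := by
  rw [Matrix.SpecialLinearGroup.coe_mul, Matrix.SpecialLinearGroup.coe_mul,
    Matrix.SpecialLinearGroup.coe_inv]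
  change !![1, s; 0, 1] * M.1 * Matrix.adjugate !![1, s; 0, 1] = _
  rw [Matrix.adjugate_fin_two_of]
  refine Matrix.ext fun i j => ?_
  simp only [Matrix.mul_apply, Fin.sum_univ_two]
  fin_cases i <;> fin_cases j <;> simp <;> ring

theorem conj_flipMatrix_val (z : ℂ) (M : SL(2, ℂ)) :
    (flipMatrix z * M * (flipMatrix z)⁻¹).1 =
      !![M.1 1 0 * z + M.1 1 1, -M.1 1 0;
        (-M.1 0 0 + z * M.1 1 0) * z + (-M.1 0 1 + z * M.1 1 1), M.1 0 0 - z * M.1 1 0] := by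
  rw [Matrix.SpecialLinearGroup.coe_mul, Matrix.SpecialLinearGroup.coe_mul,
    Matrix.SpecialLinearGroup.coe_inv]
  change !![0, 1; -1, z] * M.1 * Matrix.adjugate !![0, 1; -1, z] = _
  rw [Matrix.adjugate_fin_two_of]
  refine Matrix.ext fun i j => ?_
  simp only [Matrix.mul_apply, Fin.sum_univ_two]
  fin_cases i <;> fin_cases j <;> simp <;> ring

/-- The inverse of `flipMatrix z` sends the first basis vector to (z, 1). The quadratic equation
says that (z, 1) is an eigenvector of `M`. -/
theorem exists_conj_upper (M : SL(2, ℂ)) : ∃ A : SL(2, ℂ), (A * M * A⁻¹).1 1 0 = 0 := by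
  by_cases h : M.1 1 0 = 0
  · exact ⟨1, by simpa using h⟩
  · obtain ⟨z, hz⟩ := exists_quadratic_root h (M.1 1 1 - M.1 0 0) (-M.1 0 1)
    refine ⟨flipMatrix z, ?_⟩
    rw [conj_flipMatrix_val]
    simp only [Matrix.of_apply, Matrix.cons_val', Matrix.cons_val_zero, Matrix.cons_val_one,
      Matrix.cons_val_fin_one]
    linear_combination hz

variable {G : Type*} [CommGroup G]

theorem entries_comm (φ : G →* SL(2, ℂ)) (g h : G) (i j : Fin 2) :
    (φ g).1 i 0 * (φ h).1 0 j + (φ g).1 i 1 * (φ h).1 1 j =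
      (φ h).1 i 0 * (φ g).1 0 j + (φ h).1 i 1 * (φ g).1 1 j := by
  have := congrArg (fun M : SL(2, ℂ) => M.1 i j) (congrArg φ (mul_comm g h))
  simpa only [map_mul, Matrix.SpecialLinearGroup.coe_mul, Matrix.mul_apply,
    Fin.sum_univ_two] using this

/-- A representation of a commutative group in `SL₂(ℂ)` is conjugate to an upper triangular one. -/
theorem exists_conjRep_upper (φ : G →* SL(2, ℂ)) :
    ∃ A : SL(2, ℂ), ∀ g, (conjRep A φ g).1 1 0 = 0 := by
  by_cases hs : ∀ g, (φ g).1 1 0 = 0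
  · exact ⟨1, fun g => by simpa using hs g⟩
  push Not at hs
  obtain ⟨g₀, hg₀⟩ := hs
  -- The `A` that triangularizes `g₀` works for all `g`: otherwise commutation makes `ψ g₀` scalar.
  -- Then `φ g₀` is the same scalar matrix, against the choice of `g₀`.
  obtain ⟨A, hA⟩ := exists_conj_upper (φ g₀)
  refine ⟨A, fun g => ?_⟩
  by_contra hr
  set ψ := conjRep A φ with hψ
  have hc : (ψ g₀).1 1 0 = 0 := hA
  have e00 := entries_comm ψ g₀ g 0 0
  have e10 := entries_comm ψ g₀ g 1 0
  rw [hc] at e00 e10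
  have hb : (ψ g₀).1 0 1 = 0 := by
    have : (ψ g₀).1 0 1 * (ψ g).1 1 0 = 0 := by linear_combination e00
    exact (mul_eq_zero.1 this).resolve_right hr
  have hd : (ψ g₀).1 1 1 = (ψ g₀).1 0 0 := by
    have : ((ψ g₀).1 1 1 - (ψ g₀).1 0 0) * (ψ g).1 1 0 = 0 := by linear_combination e10
    exact sub_eq_zero.1 ((mul_eq_zero.1 this).resolve_right hr)
  have hM : (ψ g₀).1 = Matrix.scalar (Fin 2) ((ψ g₀).1 0 0) := by
    refine Matrix.ext fun i j => ?_
    fin_cases i <;> fin_cases j <;> simp [hb, hc, hd]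
  have hφ : (φ g₀).1 = Matrix.scalar (Fin 2) ((ψ g₀).1 0 0) := by
    have h1 : φ g₀ = A⁻¹ * ψ g₀ * A := by
      rw [hψ, conjRep_apply]; group
    have h2 : ψ g₀ * A = A * ψ g₀ := by
      apply Subtype.ext
      rw [Matrix.SpecialLinearGroup.coe_mul, Matrix.SpecialLinearGroup.coe_mul, hM]
      exact (Matrix.scalar_commute _ (fun r => Commute.all _ r) A.1).eq
    rw [h1, mul_assoc, h2, inv_mul_cancel_left]
    exact hM
  apply hg₀
  rw [hφ]
  simp

/-- An upper triangular representation of a commutative group having an element with distinct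
eigenvalues is conjugate to a diagonal one with the same upper left entries. -/
theorem exists_conjRep_diagonal {φ : G →* SL(2, ℂ)} (hφ : ∀ g, (φ g).1 1 0 = 0) {g₀ : G}
    (h₀ : (φ g₀).1 0 0 ^ 2 ≠ 1) : ∃ A : SL(2, ℂ), ∀ g, (conjRep A φ g).1 1 0 = 0 ∧
      (conjRep A φ g).1 0 1 = 0 ∧ (conjRep A φ g).1 0 0 = (φ g).1 0 0 := by
  have hne : (φ g₀).1 0 0 - (φ g₀).1 1 1 ≠ 0 := by
    intro h
    apply h₀
    linear_combination upper_mul_eq_one hφ g₀ + (φ g₀).1 0 0 * h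
  -- Chosen so that conjugation by `upperUnip s` makes `φ g₀` diagonal; what commutes with a
  -- diagonal matrix with distinct entries is diagonal too.
  let s := (φ g₀).1 0 1 / ((φ g₀).1 0 0 - (φ g₀).1 1 1)
  have hs : s * ((φ g₀).1 0 0 - (φ g₀).1 1 1) = (φ g₀).1 0 1 := div_mul_cancel₀ _ hne
  have hv : ∀ g, (conjRep (upperUnip s) φ g).1 =
      !![(φ g).1 0 0, -(φ g).1 0 0 * s + ((φ g).1 0 1 + s * (φ g).1 1 1); 0, (φ g).1 1 1] := by
    intro g
    rw [conjRep_apply, conj_upperUnip_val, hφ g]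
    simp
  refine ⟨upperUnip s, fun g => ?_⟩
  rw [hv]
  refine ⟨by simp, ?_, by simp⟩
  have e := entries_comm φ g₀ g 0 1
  simp only [Matrix.of_apply, Matrix.cons_val', Matrix.cons_val_zero, Matrix.cons_val_one,
    Matrix.cons_val_fin_one]
  apply mul_left_cancel₀ hne
  linear_combination e + ((φ g).1 1 1 - (φ g).1 0 0) * hs

end Triangular

namespace Knot

variable (K : Knot)

theorem peripheral_tLong : K.peripheral tLong = K.longitude := by
  simp [FramedKnot.peripheral, tLong]

theorem peripheral_tMer : K.peripheral tMer = K.meridian := by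
  simp [FramedKnot.peripheral, tMer]

variable {K}

theorem diagonalSet_subset : K.diagonalSet ⊆ K.eigenvalueSet :=
  fun _ ⟨φ, h, h1, h2⟩ => ⟨φ, fun g => (h g).1, h1, h2⟩

/-- A point of the eigenvalue set which is not one of `(±1, ±1)` lies in the diagonal set. -/
theorem mem_diagonalSet_or {x : ℂˣ × ℂˣ} (hx : x ∈ K.eigenvalueSet) :
    x ∈ K.diagonalSet ∨ ((x.1 : ℂ) ^ 2 = 1 ∧ (x.2 : ℂ) ^ 2 = 1) := by
  obtain ⟨φ, h, h1, h2⟩ := hx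
  rw [or_iff_not_imp_right, h1, h2]
  intro hne
  obtain ⟨g₀, hg₀⟩ : ∃ g₀, ((φ.comp K.peripheral) g₀).1 0 0 ^ 2 ≠ 1 := by
    by_contra! hall
    refine hne ⟨?_, ?_⟩
    · rw [← peripheral_tLong]; exact hall tLong
    · rw [← peripheral_tMer]; exact hall tMer
  obtain ⟨A, hA⟩ := exists_conjRep_diagonal (φ := φ.comp K.peripheral) h hg₀
  refine ⟨conjRep A φ, fun g => ⟨(hA g).1, (hA g).2.1⟩, ?_, ?_⟩
  · rw [h1, ← peripheral_tLong]; exact (hA tLong).2.2.symm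
  · rw [h2, ← peripheral_tMer]; exact (hA tMer).2.2.symm

/-- Conjugation by the Weyl element `flipMatrix 0` exchanges the two diagonal entries. -/
theorem inv_mem_diagonalSet {x : ℂˣ × ℂˣ} (hx : x ∈ K.diagonalSet) : x⁻¹ ∈ K.diagonalSet := by
  obtain ⟨φ, h, h1, h2⟩ := hx
  have hv : ∀ g, (conjRep (flipMatrix 0) φ (K.peripheral g)).1 =
      !![(φ (K.peripheral g)).1 1 1, 0; 0, (φ (K.peripheral g)).1 0 0] := by
    intro g
    rw [conjRep_apply, conj_flipMatrix_val, (h g).1, (h g).2]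
    simp
  have hu : ∀ g, (φ (K.peripheral g)).1 0 0 * (φ (K.peripheral g)).1 1 1 = 1 := fun g =>
    upper_mul_eq_one (φ := φ.comp K.peripheral) (fun g => (h g).1) g
  have hinv : ∀ (u : ℂˣ) g, (u : ℂ) = (φ (K.peripheral g)).1 0 0 →
      ((u⁻¹ : ℂˣ) : ℂ) = (conjRep (flipMatrix 0) φ (K.peripheral g)).1 0 0 := by
    intro u g hg
    rw [hv]
    exact Units.inv_eq_of_mul_eq_one_right (by rw [hg]; exact hu g)
  refine ⟨conjRep (flipMatrix 0) φ, fun g => ?_, ?_, ?_⟩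
  · rw [hv]; simp
  · rw [← peripheral_tLong] at h1 ⊢; exact hinv _ _ h1
  · rw [← peripheral_tMer] at h2 ⊢; exact hinv _ _ h2

/-- The Weyl element does not preserve upper triangular matrices, but points outside the diagonal
set have coordinates ±1 and are their own inverses. -/
theorem inv_mem_eigenvalueSet {x : ℂˣ × ℂˣ} (hx : x ∈ K.eigenvalueSet) :
    x⁻¹ ∈ K.eigenvalueSet := by
  rcases mem_diagonalSet_or hx with h | ⟨h1, h2⟩
  · exact diagonalSet_subset (inv_mem_diagonalSet h)
  · have e : x⁻¹ = x := by
      have : ∀ u : ℂˣ, (u : ℂ) ^ 2 = 1 → u⁻¹ = u := by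
        intro u hu
        rw [inv_eq_iff_mul_eq_one]
        ext
        rw [Units.val_mul, ← sq, hu, Units.val_one]
      exact Prod.ext (this _ h1) (this _ h2)
    rwa [e]

/-- The image of an invariant under `pHat` vanishes on the eigenvalue set if and only if its
restriction vanishes at all representations of the knot group. -/
theorem pHat_mem_vanishingIdeal_iff {f : charRing TorusGroup} :
    pHat f ∈ vanishingIdeal K.eigenvalueSet ↔
      ∀ φ : K.KnotGroup →* SL(2, ℂ), RepRing.lift φ (charRing.map K.peripheral f).1 = 0 := by
  have hmap : ∀ φ : K.KnotGroup →* SL(2, ℂ), RepRing.lift φ (charRing.map K.peripheral f).1 =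
      RepRing.lift (φ.comp K.peripheral) f.1 := fun φ => lift_map _ φ f.1
  have hval : ∀ (φ : K.KnotGroup →* SL(2, ℂ)) (x : ℂˣ × ℂˣ),
      (∀ g, (φ (K.peripheral g)).1 1 0 = 0) → (x.1 : ℂ) = (φ K.longitude).1 0 0 →
      (x.2 : ℂ) = (φ K.meridian).1 0 0 →
      RepRing.lift (φ.comp K.peripheral) f.1 = evalAt x (pHat f) := by
    intro φ x h h1 h2
    refine lift_eq_evalAt_pHat h ?_ ?_ f
    · rw [h1, ← peripheral_tLong]; rfl
    · rw [h2, ← peripheral_tMer]; rfl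
  simp only [vanishingIdeal, Submodule.mem_iInf, RingHom.mem_ker]
  constructor
  · intro hf φ
    -- Invariance allows replacing `φ` by a conjugate that is upper triangular on the peripheral
    -- subgroup.
    obtain ⟨A, hA⟩ := exists_conjRep_upper (φ.comp K.peripheral)
    have hu : ∀ g, (conjRep A φ (K.peripheral g)).1 1 0 = 0 := hA
    let χ := (upperEntry _ hA).toHomUnits
    have h1 : ((χ tLong : ℂˣ) : ℂ) = (conjRep A φ K.longitude).1 0 0 := by
      rw [← peripheral_tLong]; rfl
    have h2 : ((χ tMer : ℂˣ) : ℂ) = (conjRep A φ K.meridian).1 0 0 := by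
      rw [← peripheral_tMer]; rfl
    have h3 := hf (χ tLong, χ tMer) ⟨conjRep A φ, hu, h1, h2⟩
    rw [← lift_conjRep A φ (charRing.map K.peripheral f).2, hmap,
      hval (conjRep A φ) (χ tLong, χ tMer) hu h1 h2, h3]
  · rintro hf x ⟨φ, h, h1, h2⟩
    rw [← hval φ x h h1 h2, ← hmap, hf]

end Knot

end AffineChar
end

/-! ### Symmetric Laurent polynomials and the radical -/

noncomputable section
namespace AffineChar

section LaurentRing

open AddMonoidAlgebra

/-- The involution `l ↦ l⁻¹`, `m ↦ m⁻¹` of the ring of Laurent polynomials. -/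
def laurentInv : Laurent →ₐ[ℂ] Laurent :=
  AddMonoidAlgebra.mapDomainAlgHom ℂ ℂ (negAddMonoidHom : ℤ × ℤ →+ ℤ × ℤ)

theorem laurentInv_single (a : ℤ × ℤ) (c : ℂ) :
    laurentInv (single a c) = single (-a) c := by
  simp [laurentInv, mapDomain_single]

theorem evalAt_laurentInv (x : ℂˣ × ℂˣ) (h : Laurent) :
    evalAt x (laurentInv h) = evalAt x⁻¹ h := by
  have : (evalAt x).comp laurentInv = evalAt x⁻¹ := by
    refine AddMonoidAlgebra.algHom_ext ?_ (Subsingleton.elim _ _)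
    rintro ⟨a, b⟩
    rw [AlgHom.comp_apply, laurentInv_single, Prod.neg_mk, evalAt_single, evalAt_single]
    simp
  exact DFunLike.congr_fun this h

theorem laurentInv_laurentInv (h : Laurent) : laurentInv (laurentInv h) = h := by
  have : laurentInv.comp laurentInv = AlgHom.id ℂ Laurent := by
    refine AddMonoidAlgebra.algHom_ext ?_ (Subsingleton.elim _ _)
    intro a
    simp [laurentInv_single]
  exact DFunLike.congr_fun this h

theorem trace_univRep_mem_charRing {G : Type*} [Group G] (g : G) :
    (univRep G g).1.trace ∈ charRing G := by
  rw [mem_charRing]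
  intro A
  have h : conjAct A (univRep G g).1.trace =
      (constSL (RepRing G) A * univRep G g * (constSL (RepRing G) A)⁻¹).1.trace := by
    rw [Matrix.trace_fin_two, Matrix.trace_fin_two, map_add]
    simp only [conjAct, RepRing.lift_univ]
    rfl
  rw [h, Matrix.SpecialLinearGroup.coe_mul, Matrix.trace_mul_comm,
    ← Matrix.SpecialLinearGroup.coe_mul, inv_mul_cancel_left]

/-- This is the image of the trace of the generic matrix at λ^a μ^b, where e = (a, b). -/
theorem single_add_single_neg_mem_range_pHat (e : ℤ × ℤ) :
    single e 1 + single (-e) 1 ∈ pHat.range := by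
  let g : TorusGroup := (Multiplicative.ofAdd e.1, Multiplicative.ofAdd e.2)
  refine ⟨⟨(univRep TorusGroup g).1.trace, trace_univRep_mem_charRing g⟩, ?_⟩
  change RepRing.lift (diagRep lUnit mUnit) (univRep TorusGroup g).1.trace = _
  rw [Matrix.trace_fin_two, map_add, RepRing.lift_univ, RepRing.lift_univ, diagRep_apply,
    diagSL_val]
  have h := monomialHom_zpow (-e.1) (-e.2)
  rw [zpow_neg, zpow_neg, ← mul_inv] at h
  simp only [Matrix.of_apply, Matrix.cons_val', Matrix.cons_val_zero, Matrix.cons_val_one,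
    Matrix.cons_val_fin_one]
  exact congrArg₂ (· + ·) (monomialHom_zpow e.1 e.2) h

theorem add_laurentInv_mem_range_pHat (h : Laurent) : h + laurentInv h ∈ pHat.range := by
  induction h using AddMonoidAlgebra.induction_linear with
  | zero => simp
  | add f g hf hg =>
    rw [map_add, add_add_add_comm]
    exact add_mem hf hg
  | single e c =>
    have h := pHat.range.smul_mem (single_add_single_neg_mem_range_pHat e) c
    rw [smul_add] at h
    simpa [laurentInv_single] using h

/-- The image of `pHat` contains all Laurent polynomials invariant under the involution. -/
theorem mem_range_pHat {h : Laurent} (hh : laurentInv h = h) : h ∈ pHat.range := by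
  have := pHat.range.smul_mem (add_laurentInv_mem_range_pHat h) (1 / 2 : ℂ)
  rw [hh, smul_add, ← add_smul] at this
  norm_num at this
  simpa using this

end LaurentRing

theorem mem_vanishingIdeal {Y : Set (ℂˣ × ℂˣ)} {h : Laurent} :
    h ∈ vanishingIdeal Y ↔ ∀ x ∈ Y, evalAt x h = 0 := by
  simp only [vanishingIdeal, Submodule.mem_iInf, RingHom.mem_ker]

namespace Knot

variable {K : Knot}

theorem pHat_mem_radical {f : charRing TorusGroup}
    (hf : pHat f ∈ vanishingIdeal K.eigenvalueSet) :
    pHat f ∈ (K.peripheralIdeal.map pHat).radical := by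
  obtain ⟨n, hn⟩ := RepRing.isNilpotent_of_forall_lift_eq_zero
    (FramedKnot.mk_knotGroup_le_continuum _) _ (pHat_mem_vanishingIdeal_iff.1 hf)
  refine ⟨n, ?_⟩
  rw [← map_pow]
  apply Ideal.mem_map_of_mem
  change charRing.map K.peripheral (f ^ n) = 0
  rw [map_pow]
  exact Subtype.ext hn

/-- The radical of the ideal generated by the image of the peripheral ideal is the ideal of the
eigenvalue set. -/
theorem radical_map_pHat :
    (K.peripheralIdeal.map pHat).radical = vanishingIdeal K.eigenvalueSet := by
  apply le_antisymm
  · intro h hh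
    obtain ⟨n, hn⟩ := hh
    have hle : K.peripheralIdeal.map pHat ≤ vanishingIdeal K.eigenvalueSet := by
      rw [Ideal.map_le_iff_le_comap]
      intro f hf
      rw [Ideal.mem_comap, pHat_mem_vanishingIdeal_iff]
      intro φ
      have : charRing.map K.peripheral f = 0 := hf
      rw [this]
      exact map_zero _
    rw [mem_vanishingIdeal]
    intro x hx
    have := mem_vanishingIdeal.1 (hle hn) x hx
    rw [map_pow] at this
    exact IsReduced.eq_zero _ ⟨n, this⟩
  · intro h hh
    have hσ : laurentInv h ∈ vanishingIdeal K.eigenvalueSet := by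
      rw [mem_vanishingIdeal] at hh ⊢
      intro x hx
      rw [evalAt_laurentInv]
      exact hh _ (inv_mem_eigenvalueSet hx)
    have key : ∀ q : Laurent, laurentInv q = q → q ∈ vanishingIdeal K.eigenvalueSet →
        q ∈ (K.peripheralIdeal.map pHat).radical := by
      intro q hq hqY
      obtain ⟨f, rfl⟩ := mem_range_pHat hq
      exact pHat_mem_radical hqY
    have h1 := key (h + laurentInv h) (by rw [map_add, laurentInv_laurentInv, add_comm])
      (add_mem hh hσ)
    have h2 := key (h * laurentInv h) (by rw [map_mul, laurentInv_laurentInv, mul_comm])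
      (Ideal.mul_mem_right _ _ hh)
    have h3 : h ^ 2 ∈ (K.peripheralIdeal.map pHat).radical := by
      -- The monic quadratic with roots `h` and `laurentInv h`, evaluated at `h`.
      have e : h ^ 2 = h * (h + laurentInv h) - h * laurentInv h := by ring
      rw [e]
      exact sub_mem (Ideal.mul_mem_left _ _ h1) h2
    rw [← Ideal.radical_idem]
    exact ⟨2, h3⟩

end Knot

/-! ### Coprimality of l² - 1 and m² - 1 -/

section Coprime

open AddMonoidAlgebra

/-- Substitution of a unit `c` for `l`. -/
def substL (c : ℂˣ) : Laurent →ₐ[ℂ] AddMonoidAlgebra ℂ ℤ :=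
  AddMonoidAlgebra.lift ℂ (AddMonoidAlgebra ℂ ℤ) (ℤ × ℤ)
    { toFun := fun e => single e.toAdd.2 ((c ^ e.toAdd.1 : ℂˣ) : ℂ)
      map_one' := by
        rw [toAdd_one, Prod.fst_zero, Prod.snd_zero, zpow_zero, Units.val_one, one_def]
      map_mul' := fun a b => by
        rw [single_mul_single, toAdd_mul, Prod.fst_add, Prod.snd_add, zpow_add, Units.val_mul] }

theorem substL_single (c : ℂˣ) (a b : ℤ) :
    substL c (single (a, b) 1) = single b ((c ^ a : ℂˣ) : ℂ) := by
  simp [substL, lift_single]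

/-- The Laurent polynomial `m`. -/
def mVar : Laurent := mUnit

theorem lVar_eq : lVar = single (1, 0) 1 := by
  rw [← monomialHom_zpow 1 0, zpow_one, zpow_zero, mul_one, lVar]

theorem mVar_eq : mVar = single (0, 1) 1 := by
  rw [← monomialHom_zpow 0 1, zpow_one, zpow_zero, one_mul, mVar]

/-- Modulo l - c the variable l becomes the constant c, so the quotient map factors through `substL
c`. -/
theorem dvd_of_substL_eq_zero (c : ℂˣ) {h : Laurent} (hh : substL c h = 0) :
    lVar - algebraMap ℂ Laurent c ∣ h := by
  let I : Ideal Laurent := Ideal.span {lVar - algebraMap ℂ Laurent c}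
  let ι : AddMonoidAlgebra ℂ ℤ →ₐ[ℂ] Laurent :=
    mapDomainAlgHom ℂ ℂ (AddMonoidHom.inr ℤ ℤ)
  have hι : ∀ b z, ι (single b z) = single (0, b) z := by
    intro b z
    exact mapDomain_single
  have hl : Units.map (Ideal.Quotient.mkₐ ℂ I : Laurent →* Laurent ⧸ I) lUnit =
      Units.map (algebraMap ℂ (Laurent ⧸ I) : ℂ →* Laurent ⧸ I) c := by
    ext
    change Ideal.Quotient.mk I lVar = Ideal.Quotient.mk I (algebraMap ℂ Laurent c)
    rw [Ideal.Quotient.eq]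
    exact Ideal.mem_span_singleton_self _
  have key : Ideal.Quotient.mkₐ ℂ I = ((Ideal.Quotient.mkₐ ℂ I).comp ι).comp (substL c) := by
    refine AddMonoidAlgebra.algHom_ext ?_ (Subsingleton.elim _ _)
    rintro ⟨a, b⟩
    have e := congrArg (fun u : (Laurent ⧸ I)ˣ => ((u ^ a : (Laurent ⧸ I)ˣ) : Laurent ⧸ I)) hl
    simp only [← map_zpow] at e
    have e1 : (single (a, b) 1 : Laurent) = ((lUnit ^ a : Laurentˣ) : Laurent) * single (0, b) 1 := by
      have := monomialHom_zpow a 0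
      rw [zpow_zero, mul_one] at this
      rw [this, single_mul_single]
      simp
    have e2 : (single (0, b) ((c ^ a : ℂˣ) : ℂ) : Laurent) =
        algebraMap ℂ Laurent ((c ^ a : ℂˣ) : ℂ) * single (0, b) 1 := by
      rw [← Algebra.smul_def]
      simp
    rw [AlgHom.comp_apply, AlgHom.comp_apply, substL_single, hι, e1, e2, map_mul, map_mul]
    congr 1
  have h0 : Ideal.Quotient.mkₐ ℂ I h = 0 := by
    rw [key, AlgHom.comp_apply, hh, map_zero]
  exact Ideal.mem_span_singleton.1 (Ideal.Quotient.eq_zero_iff_mem.1 h0)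

theorem substL_lVar_sub (c : ℂˣ) : substL c (lVar - algebraMap ℂ Laurent c) = 0 := by
  rw [map_sub, lVar_eq, substL_single, AlgHom.commutes]
  simp

theorem substL_mVar_sq_sub_one_ne_zero (c : ℂˣ) : substL c (mVar ^ 2 - 1) ≠ 0 := by
  rw [map_sub, map_pow, map_one, mVar_eq, substL_single, zpow_zero, Units.val_one, single_pow,
    one_def, one_pow, sub_ne_zero, Ne, single_left_inj one_ne_zero]
  norm_num

/-- Setting l = c lands in a domain, where m² - 1 remains nonzero and can be cancelled. -/
theorem lVar_sub_dvd_of_dvd_mul (c : ℂˣ) {u : Laurent}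
    (h : lVar - algebraMap ℂ Laurent c ∣ u * (mVar ^ 2 - 1)) :
    lVar - algebraMap ℂ Laurent c ∣ u := by
  obtain ⟨v, hv⟩ := h
  have e := congrArg (substL c) hv
  rw [map_mul, map_mul, substL_lVar_sub, zero_mul] at e
  exact dvd_of_substL_eq_zero c ((mul_eq_zero.1 e).resolve_right
    (substL_mVar_sq_sub_one_ne_zero c))

theorem lVar_sub_ne_zero (c : ℂˣ) : lVar - algebraMap ℂ Laurent c ≠ 0 := by
  intro h
  have := congrArg (evalAt (Units.mk0 2 two_ne_zero * c, 1)) h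
  rw [map_sub, AlgHom.commutes, map_zero, lVar_eq, evalAt_single] at this
  simp at this
  exact c.ne_zero (by linear_combination this)

theorem lVar_sq_sub_one :
    lVar ^ 2 - 1 = (lVar - algebraMap ℂ Laurent (1 : ℂˣ)) *
      (lVar - algebraMap ℂ Laurent (-1 : ℂˣ)) := by
  simp only [Units.val_one, Units.val_neg, map_neg, map_one]
  ring

theorem lVar_sq_sub_one_dvd {u : Laurent} (h : lVar ^ 2 - 1 ∣ u * (mVar ^ 2 - 1)) :
    lVar ^ 2 - 1 ∣ u := by
  rw [lVar_sq_sub_one] at h ⊢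
  obtain ⟨v, rfl⟩ := lVar_sub_dvd_of_dvd_mul 1 ((dvd_mul_right _ _).trans h)
  rw [mul_assoc] at h
  exact mul_dvd_mul_left _ (lVar_sub_dvd_of_dvd_mul (-1)
    ((mul_dvd_mul_iff_left (lVar_sub_ne_zero 1)).1 h))

theorem lVar_sq_sub_one_ne_zero : lVar ^ 2 - 1 ≠ 0 := by
  rw [lVar_sq_sub_one]
  exact mul_ne_zero (lVar_sub_ne_zero 1) (lVar_sub_ne_zero (-1))

theorem evalAt_lVar (x : ℂˣ × ℂˣ) : evalAt x lVar = x.1 := by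
  rw [lVar_eq, evalAt_single]; simp

theorem evalAt_mVar (x : ℂˣ × ℂˣ) : evalAt x mVar = x.2 := by
  rw [mVar_eq, evalAt_single]; simp

/-- Cross-multiplying the two quotients `u` and `v` shows that l² - 1 divides u(m² - 1), hence `u`,
and can be cancelled. The case `B = 0` is separate because `B` is cancelled on the way. -/
theorem dvd_of_dvd_mul_of_dvd_mul {B h : Laurent} (h1 : B ∣ h * (lVar ^ 2 - 1))
    (h2 : B ∣ h * (mVar ^ 2 - 1)) : B ∣ h := by
  obtain ⟨u, hu⟩ := h1
  obtain ⟨v, hv⟩ := h2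
  by_cases hB : B = 0
  · rw [hB, zero_mul] at hu
    rw [(mul_eq_zero.1 hu).resolve_right lVar_sq_sub_one_ne_zero]
    exact dvd_zero B
  · have e : u * (mVar ^ 2 - 1) = (lVar ^ 2 - 1) * v := by
      apply mul_left_cancel₀ hB
      linear_combination (lVar ^ 2 - 1) * hv - (mVar ^ 2 - 1) * hu
    obtain ⟨w, rfl⟩ := lVar_sq_sub_one_dvd ⟨v, e⟩
    refine ⟨w, mul_right_cancel₀ lVar_sq_sub_one_ne_zero ?_⟩
    rw [hu]; ring

end Coprime

/-! ### The diagonal set and uniqueness of the polynomials -/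

namespace Knot

variable {K : Knot}

/-- If h vanishes on the diagonal set, its products with l² - 1 and m² - 1 vanish on the whole
eigenvalue set, so `B` divides both. -/
theorem vanishingIdeal_diagonalSet {B : Laurent} (hB : K.IsBPolynomial B) :
    vanishingIdeal K.diagonalSet = Ideal.span {B} := by
  rw [← show vanishingIdeal K.eigenvalueSet = Ideal.span {B} from hB]
  apply le_antisymm
  · intro h hh
    rw [mem_vanishingIdeal] at hh
    have key : ∀ q : Laurent, (∀ x : ℂˣ × ℂˣ, (x.1 : ℂ) ^ 2 = 1 → (x.2 : ℂ) ^ 2 = 1 →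
        evalAt x q = 0) → B ∣ h * q := by
      intro q hq
      rw [← Ideal.mem_span_singleton,
        ← show vanishingIdeal K.eigenvalueSet = Ideal.span {B} from hB, mem_vanishingIdeal]
      intro x hx
      rw [map_mul]
      rcases mem_diagonalSet_or hx with hd | ⟨h1, h2⟩
      · rw [hh x hd, zero_mul]
      · rw [hq x h1 h2, mul_zero]
    rw [show vanishingIdeal K.eigenvalueSet = Ideal.span {B} from hB, Ideal.mem_span_singleton]
    refine dvd_of_dvd_mul_of_dvd_mul (key _ fun x h1 _ => ?_) (key _ fun x _ h2 => ?_)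
    · rw [map_sub, map_pow, map_one, evalAt_lVar, h1, sub_self]
    · rw [map_sub, map_pow, map_one, evalAt_mVar, h2, sub_self]
  · intro h hh
    rw [mem_vanishingIdeal] at hh ⊢
    exact fun x hx => hh x (diagonalSet_subset hx)

theorem isBPolynomial_iff_associated {B B' : Laurent} (hB : K.IsBPolynomial B) :
    K.IsBPolynomial B' ↔ Associated B B' := by
  rw [IsBPolynomial, show vanishingIdeal K.eigenvalueSet = Ideal.span {B} from hB]
  exact Ideal.span_singleton_eq_span_singleton

theorem isAPolynomial_iff_associated {A A' : Laurent} (hA : K.IsAPolynomial A) :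
    K.IsAPolynomial A' ↔ Associated A A' := by
  have hl : lVar - 1 ≠ 0 := by simpa only [Units.val_one, map_one] using lVar_sub_ne_zero 1
  rw [IsAPolynomial, isBPolynomial_iff_associated hA.1]
  constructor
  · rintro ⟨⟨u, hu⟩, -⟩
    exact ⟨u, mul_left_cancel₀ hl (by rw [← hu, mul_assoc])⟩
  · intro h
    exact ⟨h.mul_left _, fun hd => hA.2 (hd.trans h.symm.dvd)⟩

/-- By `radical_map_pHat`, the knot enters the definition only through its peripheral ideal. -/
theorem isAPolynomial_congr {K' : Knot} (h : K.peripheralIdeal = K'.peripheralIdeal)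
    (A : Laurent) : K'.IsAPolynomial A ↔ K.IsAPolynomial A := by
  rw [IsAPolynomial, IsAPolynomial, IsBPolynomial, IsBPolynomial, ← radical_map_pHat,
    ← radical_map_pHat, h]

end Knot

end AffineChar
end

theorem mainTheorem3 (K : AffineChar.Knot) :
    (∀ B : AffineChar.Laurent, K.IsBPolynomial B →
      (K.peripheralIdeal.map AffineChar.pHat).radical = Ideal.span {B} ∧
      AffineChar.vanishingIdeal K.diagonalSet = Ideal.span {B}) ∧
    (∀ A : AffineChar.Laurent, K.IsAPolynomial A →
      (K.peripheralIdeal.map AffineChar.pHat).radical =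
        Ideal.span {(AffineChar.lVar - 1) * A}) ∧
    (∀ K' : AffineChar.Knot, K.peripheralIdeal = K'.peripheralIdeal →
      ∀ A A' : AffineChar.Laurent, K.IsAPolynomial A →
        (K'.IsAPolynomial A' ↔ Associated A A')) := by
  refine ⟨fun B hB => ⟨?_, AffineChar.Knot.vanishingIdeal_diagonalSet hB⟩, fun A hA => ?_,
    fun K' h A A' hA => ?_⟩
  · rw [AffineChar.Knot.radical_map_pHat]
    exact hB
  · rw [AffineChar.Knot.radical_map_pHat]
    exact hA.1
  · rw [AffineChar.Knot.isAPolynomial_congr h]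
    exact AffineChar.Knot.isAPolynomial_iff_associated hA
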